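/- Let $1\le d\le 28$, let $V_1,\dots,V_{d+1}\in\mathbb{R}^d$ be affinely independent, and let $S_d=\mathrm{conv}\{V_1,\dots,V_{d+1}\}$. Let $F_3\subset S_d$ be the set consisting of the vertices $V_i$ ($1\le i\le d+1$), the edge points $tV_i+(1-t)V_j$ ($i\ne j$) with $t=\frac12\bigl(1+\frac1{\sqrt5}\bigr)$, and the barycentres $\frac13(V_i+V_j+V_k)$ ($i<j<k$) of the two-dimensional faces. Then $F_3$ is a Fejér set of degree $3$ for $S_d$; that is: 1. $F_3$ consists of exactly $N=\binom{d+3}{d}=\dim \mathcal{P}_3(\mathbb{R}^d)$ distinct points of $S_d$, where $\mathcal{P}_3(\mathbb{R}^d)$ is the space of real polynomials in $d$ variables of total degree at most $3$; 2. writing $F_3=\{x_1,\dots,x_N\}$, for a basis $p_1,\dots,p_N$ of $\mathcal{P}_3(\mathbb{R}^d)$ the Vandermonde determinant $\det[p_j(x_i)]_{1\le i,j\le N}$ is non-zero (a property that does not depend on the basis), so that there are unique Lagrange polynomials $\ell_i\in\mathcal{P}_3(\mathbb{R}^d)$ with $\ell_i(x_j)=\delta_{ij}$; 3. $\displaystyle\max_{x\in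 S_d}\sum_{i=1}^{N}\ell_i(x)^2=1.$ -/

import Mathlib

noncomputable section

namespace SimplexFejer

/-- Real polynomials in `d` variables of total degree at most `n`. -/
abbrev PolySpace (d n : ℕ) : Submodule ℝ (MvPolynomial (Fin d) ℝ) :=
  MvPolynomial.restrictTotalDegree (Fin d) ℝ n

/-- The Vandermonde matrix `[p_j(x_i)]` of a basis `p` of the polynomials of degree at most `n`
and of a family of points `x` of `ℝ^d` with the same index set. -/
def vandermonde {d n : ℕ} {ι : Type*} (p : Module.Basis ι ℝ (PolySpace d n))
    (x : ι → (Fin d → ℝ)) : Matrix ι ι ℝ :=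
  Matrix.of fun i j => MvPolynomial.eval (x i) (p j : MvPolynomial (Fin d) ℝ)

/-- Interpolation at the points of `F` by polynomials of degree at most `n` is regular: the
polynomials of degree at most `n` have a basis indexed by `F` (so `F` has as many points as their
dimension), and its Vandermonde determinant at `F` is non-zero (this does not depend on the choice
of the basis). -/
def IsRegular {d : ℕ} (n : ℕ) (F : Finset (Fin d → ℝ)) : Prop :=
  ∃ p : Module.Basis F ℝ (PolySpace d n), (vandermonde p fun a : F => (a : Fin d → ℝ)).det ≠ 0

/-- `ℓ` is the family of fundamental Lagrange polynomials of degree `n` for the points of `F`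
(unique when interpolation at `F` is regular). -/
structure IsLagrangeFamily {d : ℕ} (n : ℕ) (F : Finset (Fin d → ℝ))
    (ℓ : F → MvPolynomial (Fin d) ℝ) : Prop where
  mem : ∀ a, ℓ a ∈ PolySpace d n
  eval_self : ∀ a : F, MvPolynomial.eval (a : Fin d → ℝ) (ℓ a) = 1
  eval_other : ∀ a b : F, a ≠ b → MvPolynomial.eval (b : Fin d → ℝ) (ℓ a) = 0

/-- `F` is a Fejér set of degree `n` for `S ⊆ ℝ^d`: it consists of `(n + d).choose d` distinct
points of `S`, interpolation at `F` is regular, and the sum of the squares of the Lagrange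
polynomials of `F` has maximum `1` on `S`. -/
structure IsFejerSet {d : ℕ} (n : ℕ) (S : Set (Fin d → ℝ)) (F : Finset (Fin d → ℝ)) : Prop where
  subset : ∀ a ∈ F, a ∈ S
  card_eq : F.card = (n + d).choose d
  regular : IsRegular n F
  max_eq_one : ∃ ℓ : F → MvPolynomial (Fin d) ℝ, IsLagrangeFamily n F ℓ ∧
    IsGreatest ((fun x : Fin d → ℝ => ∑ a, (MvPolynomial.eval x (ℓ a)) ^ 2) '' S) 1

/-- The simplex with the given vertices. -/
def simplex {d : ℕ} (V : Fin (d + 1) → (Fin d → ℝ)) : Set (Fin d → ℝ) :=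
  convexHull ℝ (Set.range V)

/-- The set `F₃`: the vertices, the points `t V_i + (1 - t) V_j` for `i ≠ j` with
`t = (1 + 1 / √5) / 2`, and the barycentres of the two-dimensional faces. -/
def degreeThreePoints {d : ℕ} (V : Fin (d + 1) → (Fin d → ℝ)) : Finset (Fin d → ℝ) :=
  Finset.univ.image V ∪
  ((Finset.univ : Finset (Fin (d + 1) × Fin (d + 1))).filter fun p => p.1 ≠ p.2).image
    (fun p => ((1 + 1 / √5) / 2 : ℝ) • V p.1 + (1 - (1 + 1 / √5) / 2 : ℝ) • V p.2) ∪
  ((Finset.univ : Finset (Fin (d + 1))).powersetCard 3).image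
    (fun s => (1 / 3 : ℝ) • ∑ i ∈ s, V i)

end SimplexFejer

end

/-! In barycentric coordinates the Lagrange polynomials are explicit (`nodeLagrange`), and their
duality with the points is checked directly (`nodeLagrange_nodeCoord`). Duality makes the points
distinct; since their number is the dimension, it also gives regularity. At each point the sum of
squares is 1, so what remains is the bound `∑ ℓ² ≤ 1`.

This sum is symmetric. Homogenised by `∑ xᵢ = 1`, the bound says that a sextic form D is nonnegative
at nonnegative arguments. In monomial symmetric functions, whatever the number of variables, D = 12
m51 - 72 m42 + 132 m33 + 6 m411 + 128 m321 - 822 m222 + 174 m3111 + 32 m2211 + 306 m21111 + 720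
m111111. The first three terms are the sum over pairs of 12ab(a² - 3ab + b²)², so m222 is the only
obstacle. Variables are inserted in decreasing order: once three are present, a new smallest one
cannot decrease D (`fejerDefect_le_insert`). One, two and three variables are treated by hand
(`fejerDefect_three_sorted`). -/

open Finset

/-! ### Nonnegativity of the defect -/

/-- The homogenised defect `(∑ xᵢ)⁶ - ∑ ℓ²` of the Lagrange polynomials of degree three on a
simplex, as a polynomial in the power sums `∑ xᵢ ^ k`, `1 ≤ k ≤ 6`, of the barycentric coordinates. -/
noncomputable def fejerDefect (p : ℕ → ℝ) : ℝ :=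
  p 1 ^ 6 - (36 * p 6 - 72 * p 1 * p 5 + 36 * p 1 ^ 2 * p 4 + 6 * (3 * p 1 ^ 2 - p 2) * p 4
    - 6 * (3 * p 1 ^ 2 - p 2) * p 1 * p 3 + ((3 * p 1 ^ 2 - p 2) / 2) ^ 2 * p 2
    + (175 * p 4 * p 2 + 50 * p 3 ^ 2 - 150 * p 1 * p 2 * p 3 + 25 * p 1 ^ 2 * p 2 ^ 2)
    - (225 * p 6 - 150 * p 1 * p 5 + 25 * p 1 ^ 2 * p 4)
    + 729 / 6 * (p 2 ^ 3 - 3 * p 2 * p 4 + 2 * p 6))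

/-- The power sums of a finite family. -/
noncomputable def powerSum {ι : Type*} (s : Finset ι) (x : ι → ℝ) (k : ℕ) : ℝ := ∑ i ∈ s, x i ^ k

theorem powerSum_insert {ι : Type*} [DecidableEq ι] {s : Finset ι} {i : ι} (hi : i ∉ s)
    (x : ι → ℝ) (k : ℕ) :
    powerSum (insert i s) x k = x i ^ k + powerSum s x k := sum_insert hi

theorem powerSum_nonneg {ι : Type*} {s : Finset ι} {x : ι → ℝ} (hx : ∀ i ∈ s, 0 ≤ x i) (k : ℕ) :
    0 ≤ powerSum s x k := sum_nonneg fun i hi => pow_nonneg (hx i hi) k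

theorem sum_offDiag_pow_mul_pow {ι : Type*} [DecidableEq ι] (s : Finset ι) (x : ι → ℝ) (k l : ℕ) :
    ∑ p ∈ s.offDiag, x p.1 ^ k * x p.2 ^ l
      = powerSum s x k * powerSum s x l - powerSum s x (k + l) := by
  have h : ∑ p ∈ s ×ˢ s, x p.1 ^ k * x p.2 ^ l = powerSum s x k * powerSum s x l := by
    rw [sum_product, powerSum, powerSum, sum_mul_sum]
  rw [← h, ← diag_union_offDiag, sum_union (disjoint_diag_offDiag s), sum_diag, powerSum]
  simp [pow_add]

/-- Nonnegativity of some monomial symmetric functions, written in power sums. -/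
theorem monomialSymmetric_nonneg {ι : Type*} [DecidableEq ι] (s : Finset ι) (x : ι → ℝ)
    (hx : ∀ i ∈ s, 0 ≤ x i)
    (p : ℕ → ℝ) (hp : ∀ k, p k = powerSum s x k) :
    0 ≤ p 1 ^ 2 - p 2 ∧ 0 ≤ p 2 ^ 2 - p 4 ∧ 0 ≤ p 2 * p 1 - p 3 ∧
    0 ≤ p 1 ^ 3 - 3 * p 2 * p 1 + 2 * p 3 ∧
    0 ≤ p 2 * p 1 ^ 2 - p 2 ^ 2 - 2 * p 3 * p 1 + 2 * p 4 ∧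
    0 ≤ p 2 ^ 2 * p 1 - 2 * p 3 * p 2 - p 4 * p 1 + 2 * p 5 ∧
    0 ≤ p 1 ^ 4 - 6 * p 2 * p 1 ^ 2 + 3 * p 2 ^ 2 + 8 * p 3 * p 1 - 6 * p 4 ∧
    0 ≤ p 2 * p 1 ^ 3 - 3 * p 2 ^ 2 * p 1 - 3 * p 3 * p 1 ^ 2 + 5 * p 3 * p 2 + 6 * p 4 * p 1
      - 6 * p 5 ∧
    0 ≤ p 1 ^ 5 - 10 * p 2 * p 1 ^ 3 + 15 * p 2 ^ 2 * p 1 + 20 * p 3 * p 1 ^ 2 - 20 * p 3 * p 2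
      - 30 * p 4 * p 1 + 24 * p 5 := by
  induction s using Finset.induction_on generalizing p with
  | empty => simp [hp, powerSum]
  | insert i s hi ih =>
    have hs : ∀ j ∈ s, 0 ≤ x j := fun j hj => hx j (mem_insert_of_mem hj)
    have hz : 0 ≤ x i := hx i (mem_insert_self i s)
    have hq : ∀ k, 0 ≤ powerSum s x k := powerSum_nonneg hs
    obtain ⟨h11, h22, h21, h111, h211, h221, h1111, h2111, h11111⟩ := ih hs (powerSum s x)
      fun _ => rfl
    simp only [hp, powerSum_insert hi]
    set q := powerSum s x
    set z := x i
    have e1 := hq 1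
    have e2 := hq 2
    -- The expressions are positive multiples of m11, m22, m21, m111, m211, m221, m1111, m2111,
    -- m11111. Inserting z adds terms z^k times the function with one part k removed.
    refine ⟨?_, ?_, ?_, ?_, ?_, ?_, ?_, ?_, ?_⟩
    · linear_combination h11 + 2 * z * e1
    · linear_combination h22 + 2 * z ^ 2 * e2
    · linear_combination h21 + z ^ 2 * e1 + z * e2
    · linear_combination h111 + 3 * z * h11
    · linear_combination h211 + z ^ 2 * h11 + 2 * z * h21
    · linear_combination h221 + 2 * z ^ 2 * h21 + z * h22
    · linear_combination h1111 + 4 * z * h111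
    · linear_combination h2111 + z ^ 2 * h111 + 3 * z * h211
    · linear_combination h11111 + 5 * z * h1111

/-- Half of the three-variable terms of D on {a, b, z}, plus a share of 174 m3111, where r stands
for the sum of the other variables. Without that share the expression is negative at a = b = z; `r ≥
z` repairs it. -/
theorem pair_term_nonneg {a b z r : ℝ} (hz : 0 ≤ z) (ha : z ≤ a) (hb : z ≤ b) (hr : z ≤ r) :
    0 ≤ z * (3 * (a ^ 4 * b + a * b ^ 4) + 64 * (a ^ 3 * b ^ 2 + a ^ 2 * b ^ 3))
      + z ^ 2 * (64 * (a ^ 3 * b + a * b ^ 3) - 411 * (a ^ 2 * b ^ 2))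
      + 64 * z ^ 3 * (a ^ 2 * b + a * b ^ 2) + 3 * z ^ 4 * (a * b)
      + 87 / 2 * z * ((a ^ 3 * b + a * b ^ 3) * r) := by
  obtain ⟨u, rfl⟩ := exists_add_of_le ha
  obtain ⟨v, rfl⟩ := exists_add_of_le hb
  obtain ⟨w, rfl⟩ := exists_add_of_le hr
  have hu : 0 ≤ u := by linarith
  have hv : 0 ≤ v := by linarith
  have hw : 0 ≤ w := by linarith
  -- The quotient by zab when r = z; the m3111 share raises 64 to 64 + 87/2 = 215/2.
  have key : 0 ≤ 3 * ((z + u) ^ 3 + (z + v) ^ 3) + 64 * (z + u) * (z + v) * (z + u + (z + v))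
      + z * (215 / 2 * ((z + u) ^ 2 + (z + v) ^ 2) - 411 * (z + u) * (z + v))
      + 64 * z ^ 2 * (z + u + (z + v)) + 3 * z ^ 3 := by
    nlinarith [mul_nonneg hz (mul_nonneg hu hv), mul_nonneg hz (sq_nonneg (u - v)),
      mul_nonneg (sq_nonneg z) hu, mul_nonneg (sq_nonneg z) hv, pow_nonneg hz 3,
      mul_nonneg hu (mul_nonneg hu hv), mul_nonneg hv (mul_nonneg hu hv), pow_nonneg hu 3,
      pow_nonneg hv 3, mul_nonneg hz (sq_nonneg u), mul_nonneg hz (sq_nonneg v)]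
  have h1 : 0 ≤ z * ((z + u) * (z + v)) := by positivity
  have h2 : 0 ≤ 87 / 2 * z * (((z + u) ^ 3 * (z + v) + (z + u) * (z + v) ^ 3) * w) := by positivity
  linear_combination mul_nonneg h1 key + h2

theorem add_le_powerSum_one {ι : Type*} [DecidableEq ι] {s : Finset ι} {x : ι → ℝ} {z : ℝ}
    (hz : 0 ≤ z)
    (hx : ∀ i ∈ s, z ≤ x i) (hs : 3 ≤ s.card) {i j : ι} (hi : i ∈ s) (hj : j ∈ s) (hij : i ≠ j) :
    z ≤ powerSum s x 1 - x i - x j := by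
  have hj' : j ∈ s.erase i := mem_erase.2 ⟨hij.symm, hj⟩
  have hc : 0 < ((s.erase i).erase j).card := by
    rw [card_erase_of_mem hj', card_erase_of_mem hi]; omega
  obtain ⟨k, hk⟩ := card_pos.1 hc
  have hks : k ∈ s := mem_of_mem_erase (mem_of_mem_erase hk)
  have h := single_le_sum (f := x)
    (fun l hl => hz.trans (hx l (mem_of_mem_erase (mem_of_mem_erase hl)))) hk
  have h1 := add_sum_erase s x hi
  have h2 := add_sum_erase (s.erase i) x hj'
  simp only [powerSum, pow_one]
  linarith [hx k hks]

theorem sum_pair_term_nonneg {ι : Type*} [DecidableEq ι] {s : Finset ι} {x : ι → ℝ} {z : ℝ}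
    (hz : 0 ≤ z)
    (hx : ∀ i ∈ s, z ≤ x i) (hs : 3 ≤ s.card) (p : ℕ → ℝ) (hp : ∀ k, powerSum s x k = p k) :
    0 ≤ z * (6 * (p 4 * p 1 - p 5) + 128 * (p 3 * p 2 - p 5))
      + z ^ 2 * (128 * (p 3 * p 1 - p 4) - 411 * (p 2 ^ 2 - p 4))
      + 128 * z ^ 3 * (p 2 * p 1 - p 3) + 3 * z ^ 4 * (p 1 ^ 2 - p 2)
      + 87 * z * (p 3 * p 1 ^ 2 - p 3 * p 2 - 2 * p 4 * p 1 + 2 * p 5) := by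
  have h : 0 ≤ ∑ q ∈ s.offDiag,
      (z * (3 * (x q.1 ^ 4 * x q.2 + x q.1 * x q.2 ^ 4)
          + 64 * (x q.1 ^ 3 * x q.2 ^ 2 + x q.1 ^ 2 * x q.2 ^ 3))
      + z ^ 2 * (64 * (x q.1 ^ 3 * x q.2 + x q.1 * x q.2 ^ 3) - 411 * (x q.1 ^ 2 * x q.2 ^ 2))
      + 64 * z ^ 3 * (x q.1 ^ 2 * x q.2 + x q.1 * x q.2 ^ 2) + 3 * z ^ 4 * (x q.1 * x q.2)
      + 87 / 2 * z * ((x q.1 ^ 3 * x q.2 + x q.1 * x q.2 ^ 3) * (p 1 - x q.1 - x q.2))) := by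
    refine sum_nonneg fun q hq => ?_
    obtain ⟨h1, h2, h3⟩ := mem_offDiag.1 hq
    refine pair_term_nonneg hz (hx _ h1) (hx _ h2) ?_
    rw [← hp]
    exact add_le_powerSum_one hz hx hs h1 h2 h3
  have e : ∀ k l, ∑ q ∈ s.offDiag, x q.1 ^ k * x q.2 ^ l = p k * p l - p (k + l) := by
    intro k l; rw [sum_offDiag_pow_mul_pow, hp, hp, hp]
  -- Every monomial is written with explicit exponents, including 1, so that `e` turns each sum into
  -- power sums.
  have e' : ∑ q ∈ s.offDiag,
      (z * (3 * (x q.1 ^ 4 * x q.2 + x q.1 * x q.2 ^ 4)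
          + 64 * (x q.1 ^ 3 * x q.2 ^ 2 + x q.1 ^ 2 * x q.2 ^ 3))
      + z ^ 2 * (64 * (x q.1 ^ 3 * x q.2 + x q.1 * x q.2 ^ 3) - 411 * (x q.1 ^ 2 * x q.2 ^ 2))
      + 64 * z ^ 3 * (x q.1 ^ 2 * x q.2 + x q.1 * x q.2 ^ 2) + 3 * z ^ 4 * (x q.1 * x q.2)
      + 87 / 2 * z * ((x q.1 ^ 3 * x q.2 + x q.1 * x q.2 ^ 3) * (p 1 - x q.1 - x q.2)))
      = ∑ q ∈ s.offDiag, (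
        (3 * z - 87 / 2 * z) * (x q.1 ^ 4 * x q.2 ^ 1)
        + (3 * z - 87 / 2 * z) * (x q.1 ^ 1 * x q.2 ^ 4)
        + (64 * z - 87 / 2 * z) * (x q.1 ^ 3 * x q.2 ^ 2)
        + (64 * z - 87 / 2 * z) * (x q.1 ^ 2 * x q.2 ^ 3)
        + (64 * z ^ 2 + 87 / 2 * z * p 1) * (x q.1 ^ 3 * x q.2 ^ 1)
        + (64 * z ^ 2 + 87 / 2 * z * p 1) * (x q.1 ^ 1 * x q.2 ^ 3)
        + (-411 * z ^ 2) * (x q.1 ^ 2 * x q.2 ^ 2)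
        + (64 * z ^ 3) * (x q.1 ^ 2 * x q.2 ^ 1) + (64 * z ^ 3) * (x q.1 ^ 1 * x q.2 ^ 2)
        + (3 * z ^ 4) * (x q.1 ^ 1 * x q.2 ^ 1)) := sum_congr rfl fun q _ => by ring
  rw [e'] at h
  simp only [sum_add_distrib, ← mul_sum, e] at h
  norm_num at h
  linear_combination h

/-- These are the pair terms of D that involve the new variable z, up to the factor 12. -/
theorem sum_edge_term_nonneg {ι : Type*} {s : Finset ι} {x : ι → ℝ} {z : ℝ} (hz : 0 ≤ z)
    (hx : ∀ i ∈ s, 0 ≤ x i) (p : ℕ → ℝ) (hp : ∀ k, powerSum s x k = p k) :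
    0 ≤ z * p 5 - 6 * z ^ 2 * p 4 + 11 * z ^ 3 * p 3 - 6 * z ^ 4 * p 2 + z ^ 5 * p 1 := by
  have h : 0 ≤ ∑ i ∈ s, z * x i * (x i ^ 2 - 3 * x i * z + z ^ 2) ^ 2 :=
    sum_nonneg fun i hi => mul_nonneg (mul_nonneg hz (hx i hi)) (sq_nonneg _)
  have e : ∑ i ∈ s, z * x i * (x i ^ 2 - 3 * x i * z + z ^ 2) ^ 2
      = ∑ i ∈ s, (z * x i ^ 5 + (-6 * z ^ 2) * x i ^ 4 + 11 * z ^ 3 * x i ^ 3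
        + (-6 * z ^ 4) * x i ^ 2 + z ^ 5 * x i ^ 1) := sum_congr rfl fun i _ => by ring
  rw [e] at h
  simp only [sum_add_distrib, ← mul_sum] at h
  simp only [powerSum] at hp
  simp only [hp] at h
  linear_combination h

/-- Adding to at least three numbers one that is no larger than any of them does not decrease the
defect. -/
theorem fejerDefect_le_insert {ι : Type*} [DecidableEq ι] {s : Finset ι} {x : ι → ℝ} {i : ι}
    (hi : i ∉ s) (hz : 0 ≤ x i)
    (hx : ∀ j ∈ s, x i ≤ x j) (hs : 3 ≤ s.card) :
    fejerDefect (powerSum s x) ≤ fejerDefect (powerSum (insert i s) x) := by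
  have hx0 : ∀ j ∈ s, 0 ≤ x j := fun j hj => hz.trans (hx j hj)
  obtain ⟨-, -, -, h111, h211, h221, h1111, h2111, h11111⟩ :=
    monomialSymmetric_nonneg s x hx0 (powerSum s x) fun _ => rfl
  have h1 := sum_pair_term_nonneg hz hx hs (powerSum s x) fun _ => rfl
  have h2 := sum_edge_term_nonneg hz hx0 (powerSum s x) fun _ => rfl
  simp only [fejerDefect, powerSum_insert hi]
  set p := powerSum s x
  set z := x i
  -- The increment consists of the monomials of D containing z: `h2` takes those in two variables,
  -- `h1` those in three together with z·m311, and the rest have positive coefficients.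
  linear_combination h1 + 12 * h2 + 29 * z ^ 3 * h111 + 16 * z ^ 2 * h211 + 16 * z * h221
    + 51 / 4 * z ^ 2 * h1111 + 51 * z * h2111 + 6 * z * h11111

theorem fejerDefect_three_sorted {a b c : ℝ} (hc : 0 ≤ c) (hb : c ≤ b) (ha : b ≤ a) :
    0 ≤ fejerDefect (fun k => c ^ k + (b ^ k + a ^ k)) := by
  have e : fejerDefect (fun k => c ^ k + (b ^ k + a ^ k)) =
      12 * (a * b * (a ^ 2 - 3 * a * b + b ^ 2) ^ 2 + a * c * (a ^ 2 - 3 * a * c + c ^ 2) ^ 2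
        + b * c * (b ^ 2 - 3 * b * c + c ^ 2) ^ 2)
      + a * b * c * (6 * (a ^ 3 + b ^ 3 + c ^ 3) + 128 * (a ^ 2 * b + a * b ^ 2 + a ^ 2 * c
        + a * c ^ 2 + b ^ 2 * c + b * c ^ 2) - 822 * a * b * c) := by
    simp only [fejerDefect]; ring
  rw [e]
  -- For b ≥ 2c the bracket multiplying abc is itself nonnegative. Otherwise the squares are needed,
  -- since D vanishes at a = b = c while the bracket is negative there.
  rcases le_total (2 * c) b with h | h
  · have h0 : 0 ≤ 6 * (a ^ 3 + b ^ 3 + c ^ 3) + 128 * (a ^ 2 * b + a * b ^ 2 + a ^ 2 * c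
        + a * c ^ 2 + b ^ 2 * c + b * c ^ 2) - 822 * a * b * c := by
      obtain ⟨w, rfl⟩ := exists_add_of_le h
      obtain ⟨v, rfl⟩ := exists_add_of_le ha
      have hw : 0 ≤ w := by linarith
      have hv : 0 ≤ v := by linarith
      ring_nf
      positivity
    have hb0 : 0 ≤ b := hc.trans hb
    have ha0 : 0 ≤ a := hb0.trans ha
    positivity
  · obtain ⟨x, rfl⟩ := exists_add_of_le hb
    obtain ⟨w, rfl⟩ : ∃ w, c = x + w := ⟨c - x, by ring⟩
    obtain ⟨v, rfl⟩ := exists_add_of_le ha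
    have hx : 0 ≤ x := by linarith
    have hw : 0 ≤ w := by linarith
    have hv : 0 ≤ v := by linarith
    -- In v, w, x the only negative coefficient of D is -18, at w²v⁴; subtracting 9wv³(v - w)²
    -- cancels it and leaves the others nonnegative.
    rw [← sub_add_cancel (12 * _ + _) (9 * (w * v ^ 3 * (v - w) ^ 2))]
    refine add_nonneg ?_ (by positivity)
    ring_nf
    positivity

theorem fejerDefect_powerSum_nonneg {ι : Type*} [DecidableEq ι] (s : Finset ι) (x : ι → ℝ)
    (hx : ∀ i ∈ s, 0 ≤ x i) : 0 ≤ fejerDefect (powerSum s x) := by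
  induction s using Finset.induction_on_min_value x with
  | empty => simp [fejerDefect, powerSum]
  | insert i s hi hmin ih =>
    have hz : 0 ≤ x i := hx i (mem_insert_self i s)
    have hs : ∀ j ∈ s, 0 ≤ x j := fun j hj => hx j (mem_insert_of_mem hj)
    rcases le_or_gt 3 s.card with h | h
    · exact (ih hs).trans (fejerDefect_le_insert hi hz hmin h)
    interval_cases hc : s.card
    · rw [card_eq_zero] at hc
      subst hc
      simp only [fejerDefect, powerSum, insert_empty_eq, sum_singleton]
      apply le_of_eq
      ring
    · obtain ⟨j, rfl⟩ := card_eq_one.1 hc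
      have e : fejerDefect (powerSum (insert i {j}) x)
          = 12 * (x i * x j * (x i ^ 2 - 3 * x i * x j + x j ^ 2) ^ 2) := by
        simp only [fejerDefect, powerSum_insert hi]
        simp only [powerSum, sum_singleton]
        ring
      have := hs j (mem_singleton_self j)
      rw [e]
      positivity
    · obtain ⟨j, k, hjk, rfl⟩ := card_eq_two.1 hc
      have hj := hmin j (by simp)
      have hk := hmin k (by simp)
      have e : powerSum (insert i {j, k}) x = fun l => x i ^ l + (x j ^ l + x k ^ l) := by
        funext l
        rw [powerSum_insert hi, powerSum, sum_pair hjk]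
      rw [e]
      rcases le_total (x j) (x k) with h | h
      · exact fejerDefect_three_sorted hz hj h
      · simp only [add_comm (x j ^ _)]
        exact fejerDefect_three_sorted hz hk h

/-! ### Sums of squares in terms of power sums -/

theorem sum_powersetCard_succ_insert_prod {ι : Type*} [DecidableEq ι] {s : Finset ι} {i : ι}
    (hi : i ∉ s) (y : ι → ℝ) (k : ℕ) :
    ∑ u ∈ (insert i s).powersetCard (k + 1), ∏ j ∈ u, y j
      = ∑ u ∈ s.powersetCard (k + 1), ∏ j ∈ u, y j
        + y i * ∑ u ∈ s.powersetCard k, ∏ j ∈ u, y j := by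
  have hn : ∀ {l : ℕ}, ∀ u ∈ s.powersetCard l, i ∉ u := fun u hu h =>
    hi ((mem_powersetCard.1 hu).1 h)
  rw [powersetCard_succ_insert hi, sum_union, sum_image, mul_sum]
  · exact congrArg _ (sum_congr rfl fun u hu => prod_insert (hn u hu))
  · intro u hu v hv h
    rw [← erase_insert (hn u hu), ← erase_insert (hn v hv)]
    exact congrArg (fun w => w.erase i) h
  · refine disjoint_left.2 fun u hu hu' => hn u hu ?_
    obtain ⟨v, -, rfl⟩ := mem_image.1 hu'
    exact mem_insert_self i v

theorem sum_powersetCard_three_prod {ι : Type*} [DecidableEq ι] (s : Finset ι) (y : ι → ℝ) :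
    6 * ∑ u ∈ s.powersetCard 3, ∏ j ∈ u, y j
      = powerSum s y 1 ^ 3 - 3 * powerSum s y 1 * powerSum s y 2 + 2 * powerSum s y 3 := by
  have h1 : ∀ s : Finset ι, ∑ u ∈ s.powersetCard 1, ∏ j ∈ u, y j = powerSum s y 1 := by
    intro s
    simp [powersetCard_one, powerSum]
  have h2 : ∀ s : Finset ι, 2 * ∑ u ∈ s.powersetCard 2, ∏ j ∈ u, y j
      = powerSum s y 1 ^ 2 - powerSum s y 2 := by
    intro s
    induction s using Finset.induction_on with
    | empty =>
      rw [powersetCard_eq_empty.2 (by simp)]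
      simp [powerSum]
    | insert i s hi ih =>
      rw [sum_powersetCard_succ_insert_prod hi, powerSum_insert hi, powerSum_insert hi, h1]
      linear_combination ih
  induction s using Finset.induction_on with
  | empty =>
    rw [powersetCard_eq_empty.2 (by simp)]
    simp [powerSum]
  | insert i s hi ih =>
    rw [sum_powersetCard_succ_insert_prod hi, powerSum_insert hi, powerSum_insert hi,
      powerSum_insert hi]
    linear_combination ih + 3 * y i * h2 s

theorem sum_vertex_sq {ι : Type*} (s : Finset ι) (x : ι → ℝ) (p : ℕ → ℝ)
    (hp : ∀ k, powerSum s x k = p k) (c : ℝ) :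
    ∑ i ∈ s, (6 * x i ^ 3 - 6 * x i ^ 2 + c * x i) ^ 2
      = 36 * p 6 - 72 * p 5 + (36 + 12 * c) * p 4 - 12 * c * p 3 + c ^ 2 * p 2 := by
  simp only [powerSum] at hp
  simp only [← hp, mul_sum, ← sum_add_distrib, ← sum_sub_distrib]
  exact sum_congr rfl fun i _ => by ring

/-- Summing over both orders of a pair cancels the terms odd in r, so only r² = 5 enters. -/
theorem sum_offDiag_edge_sq {ι : Type*} [DecidableEq ι] (s : Finset ι) (x : ι → ℝ) (p : ℕ → ℝ)
    (hp : ∀ k, powerSum s x k = p k) {r : ℝ} (hr : r ^ 2 = 5) :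
    ∑ q ∈ s.offDiag, (x q.1 * x q.2 * (5 / 2 * (1 + r) * x q.1 + 5 / 2 * (1 - r) * x q.2
        - 5 * (1 - x q.1 - x q.2))) ^ 2
      = 175 * p 4 * p 2 + 50 * p 3 ^ 2 - 150 * p 2 * p 3 + 25 * p 2 ^ 2
        - (225 * p 6 - 150 * p 5 + 25 * p 4) := by
  have e : ∀ k l, ∑ q ∈ s.offDiag, x q.1 ^ k * x q.2 ^ l = p k * p l - p (k + l) := by
    intro k l; rw [sum_offDiag_pow_mul_pow, hp, hp, hp]
  have e' : ∑ q ∈ s.offDiag, (x q.1 * x q.2 * (5 / 2 * (1 + r) * x q.1 + 5 / 2 * (1 - r) * x q.2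
        - 5 * (1 - x q.1 - x q.2))) ^ 2
      = ∑ q ∈ s.offDiag, ((5 / 2 * (1 + r) + 5) ^ 2 * (x q.1 ^ 4 * x q.2 ^ 2)
        + (5 / 2 * (1 - r) + 5) ^ 2 * (x q.1 ^ 2 * x q.2 ^ 4)
        + 2 * (5 / 2 * (1 + r) + 5) * (5 / 2 * (1 - r) + 5) * (x q.1 ^ 3 * x q.2 ^ 3)
        + (- 10 * (5 / 2 * (1 + r) + 5)) * (x q.1 ^ 3 * x q.2 ^ 2)
        + (- 10 * (5 / 2 * (1 - r) + 5)) * (x q.1 ^ 2 * x q.2 ^ 3)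
        + 25 * (x q.1 ^ 2 * x q.2 ^ 2)) := sum_congr rfl fun q _ => by ring
  rw [e']
  simp only [sum_add_distrib, ← mul_sum, e]
  norm_num
  linear_combination (25 / 2 * (p 4 * p 2 - p 6) - 25 / 2 * (p 3 ^ 2 - p 6)) * hr

theorem sum_powersetCard_three_sq {ι : Type*} [DecidableEq ι] (s : Finset ι) (x : ι → ℝ)
    (p : ℕ → ℝ) (hp : ∀ k, powerSum s x k = p k) :
    ∑ u ∈ s.powersetCard 3, (27 * ∏ j ∈ u, x j) ^ 2
      = 729 / 6 * (p 2 ^ 3 - 3 * p 2 * p 4 + 2 * p 6) := by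
  have h := sum_powersetCard_three_prod s (fun j => x j ^ 2)
  have e : ∀ k, powerSum s (fun j => x j ^ 2) k = p (2 * k) := fun k => by
    simp only [← hp, powerSum, pow_mul]
  rw [e, e, e] at h
  simp only [mul_pow, ← prod_pow, ← mul_sum]
  norm_num at h ⊢
  linear_combination 729 / 6 * h

/-! ### Nodes, Lagrange polynomials and their duality -/

/-- Indices of the points: vertices, ordered pairs of vertices, and triples of vertices. -/
abbrev NodeIndex (ι : Type*) [Fintype ι] [DecidableEq ι] : Type _ :=
  ι ⊕ {q : ι × ι // q ∈ (univ : Finset ι).offDiag} ⊕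
    {u : Finset ι // u ∈ (univ : Finset ι).powersetCard 3}

/-- Barycentric coordinates of the points. -/
noncomputable def nodeCoord {ι : Type*} [Fintype ι] [DecidableEq ι] : NodeIndex ι → ι → ℝ
  | .inl k, i => if i = k then 1 else 0
  | .inr (.inl q), i =>
    if i = q.1.1 then (1 + 1 / √5) / 2 else if i = q.1.2 then 1 - (1 + 1 / √5) / 2 else 0
  | .inr (.inr u), i => if i ∈ u.1 then 1 / 3 else 0

/-- The Lagrange polynomials of degree three as functions of the barycentric coordinates. -/
noncomputable def nodeLagrange {ι A : Type*} [Fintype ι] [DecidableEq ι] [CommRing A] [Algebra ℝ A]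
    (x : ι → A) : NodeIndex ι → A
  | .inl i => 6 * x i ^ 3 - 6 * x i ^ 2
      + (algebraMap ℝ A (3 / 2) - algebraMap ℝ A (1 / 2) * ∑ j, x j ^ 2) * x i
  | .inr (.inl q) => x q.1.1 * x q.1.2 * (algebraMap ℝ A (5 / 2 * (1 + √5)) * x q.1.1
      + algebraMap ℝ A (5 / 2 * (1 - √5)) * x q.1.2 - 5 * (1 - x q.1.1 - x q.1.2))
  | .inr (.inr u) => 27 * ∏ j ∈ u.1, x j

theorem map_nodeLagrange {ι A B : Type*} [Fintype ι] [DecidableEq ι] [CommRing A] [Algebra ℝ A]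
    [CommRing B] [Algebra ℝ B] (f : A →ₐ[ℝ] B) (x : ι → A) (n : NodeIndex ι) :
    f (nodeLagrange x n) = nodeLagrange (fun i => f (x i)) n := by
  rcases n with i | q | u <;> simp only [nodeLagrange, map_add, map_sub, map_mul, map_pow, map_sum,
    map_prod, map_ofNat, map_one, AlgHom.commutes]

theorem sum_nodeLagrange_sq_le_one {ι : Type*} [Fintype ι] [DecidableEq ι] (x : ι → ℝ)
    (hx : ∀ i, 0 ≤ x i) (h1 : ∑ i, x i = 1) : ∑ n, nodeLagrange x n ^ 2 ≤ 1 := by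
  have hD := fejerDefect_powerSum_nonneg univ x fun i _ => hx i
  set p := powerSum univ x with hp
  have hp1 : p 1 = 1 := by simpa [hp, powerSum] using h1
  have hp2 : ∑ j, x j ^ 2 = p 2 := rfl
  have hr : √5 ^ 2 = (5 : ℝ) := Real.sq_sqrt (by norm_num)
  rw [Fintype.sum_sum_type, Fintype.sum_sum_type]
  simp only [nodeLagrange, Algebra.algebraMap_self, RingHom.id_apply, hp2]
  rw [sum_vertex_sq univ x p (fun _ => rfl),
    sum_coe_sort univ.offDiag fun q : ι × ι => (x q.1 * x q.2 * (5 / 2 * (1 + √5) * x q.1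
      + 5 / 2 * (1 - √5) * x q.2 - 5 * (1 - x q.1 - x q.2))) ^ 2,
    sum_offDiag_edge_sq univ x p (fun _ => rfl) hr,
    sum_coe_sort (univ.powersetCard 3) fun u : Finset ι => (27 * ∏ j ∈ u, x j) ^ 2,
    sum_powersetCard_three_sq univ x p fun _ => rfl]
  simp only [fejerDefect, hp1] at hD
  linear_combination hD

theorem sum_nodeCoord {ι : Type*} [Fintype ι] [DecidableEq ι] (n : NodeIndex ι) :
    ∑ i, nodeCoord n i = 1 := by
  rcases n with k | ⟨⟨k, l⟩, hq⟩ | ⟨u, hu⟩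
  · simp [nodeCoord]
  · have hkl : k ≠ l := (mem_offDiag.1 hq).2.2
    simp only [nodeCoord]
    rw [← add_sum_erase _ _ (mem_univ k), if_pos rfl,
      ← add_sum_erase _ _ (mem_erase.2 ⟨hkl.symm, mem_univ l⟩), if_neg hkl.symm, if_pos rfl,
      sum_eq_zero]
    · ring
    · intro i hi
      simp only [mem_erase] at hi
      rw [if_neg hi.2.1, if_neg hi.1]
  · have h3 : u.card = 3 := (mem_powersetCard.1 hu).2
    simp only [nodeCoord]
    rw [sum_ite_mem, univ_inter, sum_const, h3]
    norm_num

/-- The sum of squares σ depends only on the type of node, which lets a single term in σ adapt the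
vertex polynomial to all three types. -/
theorem sum_nodeCoord_sq {ι : Type*} [Fintype ι] [DecidableEq ι] (n : NodeIndex ι) :
    ∑ i, nodeCoord n i ^ 2 = match n with
      | .inl _ => 1
      | .inr (.inl _) => 3 / 5
      | .inr (.inr _) => 1 / 3 := by
  rcases n with k | ⟨⟨k, l⟩, hq⟩ | ⟨u, hu⟩
  · simp [nodeCoord]
  · have hkl : k ≠ l := (mem_offDiag.1 hq).2.2
    have hr : (1 / √5) ^ 2 = (1 / 5 : ℝ) := by rw [div_pow, Real.sq_sqrt (by norm_num), one_pow]
    simp only [nodeCoord]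
    rw [← add_sum_erase _ _ (mem_univ k), if_pos rfl,
      ← add_sum_erase _ _ (mem_erase.2 ⟨hkl.symm, mem_univ l⟩), if_neg hkl.symm, if_pos rfl,
      sum_eq_zero]
    · linear_combination (1 / 2) * hr
    · intro i hi
      simp only [mem_erase] at hi
      rw [if_neg hi.2.1, if_neg hi.1]
      norm_num
  · have h3 : u.card = 3 := (mem_powersetCard.1 hu).2
    simp only [nodeCoord, ite_pow]
    rw [zero_pow two_ne_zero, sum_ite_mem, univ_inter, sum_const, h3]
    norm_num

/-- The polynomial is x times 6x² - 6x + (3 - σ)/2. For σ = 3/5 the quadratic has roots (1 ±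
1/√5)/2, for σ = 1/3 it vanishes at 1/3, and for σ = 1 it equals 1 at x = 1. -/
theorem nodeLagrange_vertex {ι : Type*} [Fintype ι] [DecidableEq ι] (i : ι) (n : NodeIndex ι) :
    nodeLagrange (nodeCoord n) (.inl i) = if .inl i = n then 1 else 0 := by
  have hr : (1 / √5) ^ 2 = (1 / 5 : ℝ) := by rw [div_pow, Real.sq_sqrt (by norm_num), one_pow]
  simp only [nodeLagrange, Algebra.algebraMap_self, RingHom.id_apply, sum_nodeCoord_sq]
  rcases n with k | ⟨⟨k, l⟩, hq⟩ | ⟨u, hu⟩ <;>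
    simp only [nodeCoord, reduceCtorEq, if_false, Sum.inl.injEq]
  · split_ifs <;> norm_num
  · split_ifs
    · linear_combination (3 / 4 * (1 + 1 / √5)) * hr
    · linear_combination (3 / 4 * (1 - 1 / √5)) * hr
    · norm_num
  · split_ifs <;> norm_num

/-- The two √5 coefficients make the linear factor 5 at the edge point, where the product of
coordinates is 1/5, and 0 at the reversed point. They add up to 5, so -5(1 - x - y) cancels them at
the barycentres. -/
theorem nodeLagrange_edge {ι : Type*} [Fintype ι] [DecidableEq ι]
    (q : {q : ι × ι // q ∈ (univ : Finset ι).offDiag}) (n : NodeIndex ι) :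
    nodeLagrange (nodeCoord n) (.inr (.inl q)) = if .inr (.inl q) = n then 1 else 0 := by
  have hr : √5 * (1 / √5) = (1 : ℝ) := mul_one_div_cancel (by positivity)
  have hr2 : (1 / √5) ^ 2 = (1 / 5 : ℝ) := by rw [div_pow, Real.sq_sqrt (by norm_num), one_pow]
  obtain ⟨⟨i, j⟩, hij⟩ := q
  have hij' : i ≠ j := (mem_offDiag.1 hij).2.2
  rcases n with k | ⟨⟨k, l⟩, hq⟩ | ⟨u, hu⟩ <;>
    simp only [nodeLagrange, Algebra.algebraMap_self, RingHom.id_apply, nodeCoord, reduceCtorEq,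
      if_false, Sum.inl.injEq, Sum.inr.injEq, Subtype.mk.injEq, Prod.mk.injEq]
  · by_cases h : i = k
    · have hj : j ≠ k := fun h' => hij' (h.trans h'.symm)
      simp [hj]
    · simp [h]
  · have hkl : k ≠ l := (mem_offDiag.1 hq).2.2
    generalize 1 / √5 = r at hr hr2 ⊢
    by_cases hik : i = k
    · have hjk : j ≠ k := fun h' => hij' (hik.trans h'.symm)
      by_cases hjl : j = l
      · simp only [hik, hjl, hkl.symm, if_true, if_false, and_self]
        linear_combination (1 - r ^ 2) / 4 * (5 / 2) * hr - 5 / 4 * hr2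
      · simp [hik, hjl, hjk]
    · by_cases hjk : j = k
      · by_cases hil : i = l
        · simp only [hjk, hil, hkl, hkl.symm, if_true, if_false, and_self]
          linear_combination -(1 - r ^ 2) / 4 * (5 / 2) * hr
        · simp [hik, hil]
      · by_cases hil : i = l
        · have hjl : j ≠ l := fun h' => hij' (hil.trans h'.symm)
          simp [hik, hjk, hjl]
        · simp [hik, hil]
  · split_ifs
    · ring
    all_goals ring

/-- At any other node some index of the triple lies outside the support, which kills the product. -/
theorem nodeLagrange_face {ι : Type*} [Fintype ι] [DecidableEq ι]
    (u : {u : Finset ι // u ∈ (univ : Finset ι).powersetCard 3}) (n : NodeIndex ι) :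
    nodeLagrange (nodeCoord n) (.inr (.inr u)) = if .inr (.inr u) = n then 1 else 0 := by
  obtain ⟨u, hu⟩ := u
  have h3 : u.card = 3 := (mem_powersetCard.1 hu).2
  have hout : ∀ {w : Finset ι}, w.card ≤ u.card → u ≠ w → ∃ i ∈ u, i ∉ w := by
    intro w hw huw
    by_contra! h
    exact huw (eq_of_subset_of_card_le h hw)
  rcases n with k | ⟨⟨k, l⟩, hq⟩ | ⟨v, hv⟩ <;>
    simp only [nodeLagrange, reduceCtorEq, if_false, Sum.inr.injEq, Subtype.mk.injEq]
  · obtain ⟨i, hi, hik⟩ := hout (w := {k}) (by simp [h3]) fun h => by simp [h] at h3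
    rw [prod_eq_zero hi, mul_zero]
    simpa [nodeCoord] using hik
  · have hw : ({k, l} : Finset ι).card < u.card := card_le_two.trans_lt (by omega)
    obtain ⟨i, hi, hik⟩ := hout hw.le fun h => hw.ne (by rw [h])
    simp only [mem_insert, mem_singleton, not_or] at hik
    rw [prod_eq_zero hi, mul_zero]
    simp [nodeCoord, hik]
  · split_ifs with h
    · subst h
      rw [prod_congr rfl (g := fun _ => (1 / 3 : ℝ)) fun i hi => by simp [nodeCoord, hi],
        prod_const, h3]
      norm_num
    · have h3' : v.card = 3 := (mem_powersetCard.1 hv).2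
      obtain ⟨i, hi, hik⟩ := hout (w := v) (by omega) h
      rw [prod_eq_zero hi, mul_zero]
      simp [nodeCoord, hik]

/-- The Lagrange polynomials are dual to the points. -/
theorem nodeLagrange_nodeCoord {ι : Type*} [Fintype ι] [DecidableEq ι] (m n : NodeIndex ι) :
    nodeLagrange (nodeCoord n) m = if m = n then 1 else 0 := by
  rcases m with i | q | u
  · exact nodeLagrange_vertex i n
  · exact nodeLagrange_edge q n
  · exact nodeLagrange_face u n

/-! ### Counting, degrees and regularity -/

theorem card_nodeIndex (d : ℕ) : Fintype.card (NodeIndex (Fin (d + 1))) = (3 + d).choose d := by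
  rw [Fintype.card_sum, Fintype.card_sum, Fintype.card_coe, Fintype.card_coe, offDiag_card,
    card_powersetCard, card_univ, Fintype.card_fin, ← Nat.choose_symm_add]
  have h : ∀ m : ℕ, (m + 1) * m = 2 * (m + 1).choose 2 := fun m => by
    rw [Nat.choose_two_right, Nat.add_sub_cancel, Nat.mul_div_cancel' (by
      rw [mul_comm]; exact (Nat.even_mul_succ_self m).two_dvd)]
  have h2 := h d
  have e3 : (3 + d).choose 3 = (d + 1).choose 1 + 2 * (d + 1).choose 2 + (d + 1).choose 3 := by
    rw [show 3 + d = d + 1 + 1 + 1 by ring, Nat.choose_succ_succ' (d + 1 + 1) 2,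
      Nat.choose_succ_succ' (d + 1) 2, Nat.choose_succ_succ' (d + 1) 1]
    ring
  rw [e3, ← h2, Nat.choose_one_right, add_mul, mul_add]
  have h5 : d * d + d + (d + 1) - (d + 1) = d * d + d := Nat.add_sub_cancel _ _
  ring_nf at h5 ⊢
  omega

/-- The dimension of the space of polynomials of degree at most three. -/
theorem finrank_polySpace_three (d : ℕ) :
    Module.finrank ℝ (SimplexFejer.PolySpace d 3) = (3 + d).choose d := by
  have hset : {n : Fin d →₀ ℕ | (n.sum fun _ e => e) ≤ 3}
      = ↑((range 4).biUnion fun k => (univ : Finset (Fin d)).finsuppAntidiag k) := by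
    ext n
    simp [mem_finsuppAntidiag, Finsupp.sum_fintype, Nat.lt_succ_iff]
  have hdisj : Set.PairwiseDisjoint (range 4 : Set ℕ)
      fun k => (univ : Finset (Fin d)).finsuppAntidiag k := fun k _ l _ hkl =>
    disjoint_left.2 fun n hn hn' =>
      hkl ((mem_finsuppAntidiag.1 hn).1.symm.trans (mem_finsuppAntidiag.1 hn').1)
  rw [SimplexFejer.PolySpace, MvPolynomial.restrictTotalDegree, Module.finrank_eq_nat_card_basis
    (MvPolynomial.basisRestrictSupport ℝ {n : Fin d →₀ ℕ | (n.sum fun _ e => e) ≤ 3}),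
    hset, Nat.card_coe_set_eq, Set.ncard_coe_finset, card_biUnion hdisj]
  simp only [card_finsuppAntidiag_nat_eq_multichoose, card_univ, Fintype.card_fin,
    sum_range_succ, sum_range_zero]
  -- Unrolling the recursion in the degree sums the monomial counts for degrees 0 to 3.
  have h := Nat.multichoose_eq (d + 1) 3
  rw [Nat.multichoose_succ_succ, Nat.multichoose_succ_succ, Nat.multichoose_succ_succ,
    show d + 1 + 3 - 1 = 3 + d by omega, Nat.choose_symm_add] at h
  simp only [Nat.multichoose_zero_right, zero_add, one_add_one_eq_two, Nat.reduceAdd] at h ⊢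
  omega

/-- An affine function on `ℝ^d` as a polynomial. -/
noncomputable def affinePolynomial {d : ℕ} (f : (Fin d → ℝ) →ᵃ[ℝ] ℝ) : MvPolynomial (Fin d) ℝ :=
  MvPolynomial.C (f 0)
    + ∑ k, MvPolynomial.C (f.linear fun j => if k = j then 1 else 0) * MvPolynomial.X k

theorem eval_affinePolynomial {d : ℕ} (f : (Fin d → ℝ) →ᵃ[ℝ] ℝ) (x : Fin d → ℝ) :
    MvPolynomial.eval x (affinePolynomial f) = f x := by
  have h := congrFun f.decomp x
  rw [Pi.add_apply, LinearMap.pi_apply_eq_sum_univ f.linear x] at h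
  simp only [affinePolynomial, map_add, map_sum, map_mul, MvPolynomial.eval_C, MvPolynomial.eval_X,
    h, smul_eq_mul, mul_comm, add_comm]

theorem totalDegree_affinePolynomial_le {d : ℕ} (f : (Fin d → ℝ) →ᵃ[ℝ] ℝ) :
    (affinePolynomial f).totalDegree ≤ 1 := by
  refine (MvPolynomial.totalDegree_add _ _).trans (max_le (by simp) ?_)
  refine MvPolynomial.totalDegree_finsetSum_le fun k _ => ?_
  refine (MvPolynomial.totalDegree_mul _ _).trans ?_
  simp [MvPolynomial.totalDegree_X]

theorem totalDegree_nodeLagrange_le {ι σ : Type*} [Fintype ι] [DecidableEq ι]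
    (L : ι → MvPolynomial σ ℝ) (hL : ∀ i, (L i).totalDegree ≤ 1) (n : NodeIndex ι) :
    (nodeLagrange L n).totalDegree ≤ 3 := by
  have mul : ∀ {p q : MvPolynomial σ ℝ} (k l : ℕ), p.totalDegree ≤ k → q.totalDegree ≤ l →
      (p * q).totalDegree ≤ k + l := fun k l hp hq =>
    (MvPolynomial.totalDegree_mul _ _).trans (add_le_add hp hq)
  have sub : ∀ {p q : MvPolynomial σ ℝ} {k : ℕ}, p.totalDegree ≤ k → q.totalDegree ≤ k →
      (p - q).totalDegree ≤ k := fun hp hq =>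
    (MvPolynomial.totalDegree_sub _ _).trans (max_le hp hq)
  have add : ∀ {p q : MvPolynomial σ ℝ} {k : ℕ}, p.totalDegree ≤ k → q.totalDegree ≤ k →
      (p + q).totalDegree ≤ k := fun hp hq =>
    (MvPolynomial.totalDegree_add _ _).trans (max_le hp hq)
  have pow : ∀ i k, (L i ^ k).totalDegree ≤ k := fun i k =>
    (MvPolynomial.totalDegree_pow _ _).trans
      ((Nat.mul_le_mul_left k (hL i)).trans (mul_one k).le)
  have const : ∀ (c : ℝ) (k : ℕ), (algebraMap ℝ (MvPolynomial σ ℝ) c).totalDegree ≤ k :=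
    fun c k => by rw [MvPolynomial.algebraMap_eq, MvPolynomial.totalDegree_C]; exact k.zero_le
  have num : ∀ (c k : ℕ) [c.AtLeastTwo],
      (OfNat.ofNat c : MvPolynomial σ ℝ).totalDegree ≤ k := fun c k _ => by
    rw [← map_ofNat (algebraMap ℝ (MvPolynomial σ ℝ)) c]; exact const _ k
  have one : ∀ k, (1 : MvPolynomial σ ℝ).totalDegree ≤ k := fun k => by simp
  rcases n with i | q | ⟨u, hu⟩
  -- Constants receive surplus degree where needed, so that both sides of each sum have the same
  -- bound.
  · refine add (sub (mul 0 3 (num 6 0) (pow i 3)) (mul 1 2 (num 6 1) (pow i 2)))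
      (mul 2 1 (sub (const _ 2) (mul 0 2 (const _ 0) ?_)) (hL i))
    exact MvPolynomial.totalDegree_finsetSum_le fun j _ => pow j 2
  · exact mul 2 1 (mul 1 1 (hL _) (hL _))
      (sub (add (mul 0 1 (const _ 0) (hL _)) (mul 0 1 (const _ 0) (hL _)))
        (mul 0 1 (num 5 0) (sub (sub (one 1) (hL _)) (hL _))))
  · refine mul 0 3 (num 27 0) ((MvPolynomial.totalDegree_finsetProd _ _).trans ?_)
    refine (sum_le_sum fun j _ => hL j).trans ?_
    rw [sum_const, (mem_powersetCard.1 hu).2, smul_eq_mul, mul_one]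

/-- By duality the Lagrange family is independent, hence a basis by dimension, and its Vandermonde
matrix is the identity. -/
theorem SimplexFejer.IsLagrangeFamily.isRegular {d n : ℕ} {F : Finset (Fin d → ℝ)}
    {ℓ : F → MvPolynomial (Fin d) ℝ} (hℓ : IsLagrangeFamily n F ℓ) (hF : F.Nonempty)
    (hcard : F.card = Module.finrank ℝ (PolySpace d n)) : IsRegular n F := by
  classical
  have heval : ∀ a b : F, MvPolynomial.eval (b : Fin d → ℝ) (ℓ a) = if a = b then 1 else 0 := by
    intro a b
    split_ifs with h
    · rw [← h, hℓ.eval_self]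
    · exact hℓ.eval_other a b h
  let v : F → PolySpace d n := fun a => ⟨ℓ a, hℓ.mem a⟩
  have hv : LinearIndependent ℝ v := by
    refine Fintype.linearIndependent_iff.2 fun g hg b => ?_
    have h := congrArg (fun q : PolySpace d n => MvPolynomial.eval (b : Fin d → ℝ) q.1) hg
    simpa [v, MvPolynomial.smul_eval, heval] using h
  have : Nonempty F := hF.to_subtype
  refine ⟨basisOfLinearIndependentOfCardEqFinrank hv (by simpa using hcard), ?_⟩
  have h1 : vandermonde (basisOfLinearIndependentOfCardEqFinrank hv (by simpa using hcard))
      (fun a : F => (a : Fin d → ℝ)) = 1 := by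
    ext a b
    simp [vandermonde, v, heval, Matrix.one_apply, eq_comm]
  rw [h1, Matrix.det_one]
  exact one_ne_zero

/-! ### The points in the simplex and the conclusion -/

/-- The point with the given index. -/
noncomputable def nodePoint {ι : Type*} [Fintype ι] [DecidableEq ι] {d : ℕ} (V : ι → Fin d → ℝ)
    (n : NodeIndex ι) : Fin d → ℝ := ∑ i, nodeCoord n i • V i

theorem nodePoint_vertex {ι : Type*} [Fintype ι] [DecidableEq ι] {d : ℕ} (V : ι → Fin d → ℝ)
    (i : ι) : nodePoint V (.inl i) = V i := by
  simp [nodePoint, nodeCoord]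

theorem nodePoint_edge {ι : Type*} [Fintype ι] [DecidableEq ι] {d : ℕ} (V : ι → Fin d → ℝ)
    (q : {q : ι × ι // q ∈ (univ : Finset ι).offDiag}) : nodePoint V (.inr (.inl q))
      = ((1 + 1 / √5) / 2 : ℝ) • V q.1.1 + (1 - (1 + 1 / √5) / 2 : ℝ) • V q.1.2 := by
  have h : q.1.1 ≠ q.1.2 := (mem_offDiag.1 q.2).2.2
  simp only [nodePoint, nodeCoord]
  rw [← add_sum_erase _ _ (mem_univ q.1.1), if_pos rfl,
    ← add_sum_erase _ _ (mem_erase.2 ⟨h.symm, mem_univ q.1.2⟩), if_neg h.symm, if_pos rfl,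
    sum_eq_zero, add_zero]
  intro i hi
  simp only [mem_erase] at hi
  rw [if_neg hi.2.1, if_neg hi.1, zero_smul]

theorem nodePoint_face {ι : Type*} [Fintype ι] [DecidableEq ι] {d : ℕ} (V : ι → Fin d → ℝ)
    (u : {u : Finset ι // u ∈ (univ : Finset ι).powersetCard 3}) :
    nodePoint V (.inr (.inr u)) = (1 / 3 : ℝ) • ∑ i ∈ u.1, V i := by
  simp only [nodePoint, nodeCoord, ite_smul, zero_smul]
  rw [sum_ite_mem, univ_inter, smul_sum]

theorem degreeThreePoints_eq_image {d : ℕ} (V : Fin (d + 1) → (Fin d → ℝ)) :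
    SimplexFejer.degreeThreePoints V = univ.image (nodePoint V) := by
  ext x
  simp only [SimplexFejer.degreeThreePoints, mem_union, mem_image, mem_univ, true_and, mem_filter,
    Sum.exists, nodePoint_vertex, nodePoint_edge, nodePoint_face, Subtype.exists, mem_offDiag,
    or_assoc, exists_prop, ne_eq]

theorem nodeCoord_nonneg {ι : Type*} [Fintype ι] [DecidableEq ι] (n : NodeIndex ι) (i : ι) :
    0 ≤ nodeCoord n i := by
  have h : 1 / √5 ≤ (1 : ℝ) :=
    div_le_one_of_le₀ (Real.one_le_sqrt.2 (by norm_num)) (Real.sqrt_nonneg 5)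
  rcases n with k | q | u <;> simp only [nodeCoord] <;> split_ifs <;>
    first | positivity | linarith

theorem AffineBasis.coord_sum_smul {ι E : Type*} [Fintype ι] [AddCommGroup E] [Module ℝ E]
    (b : AffineBasis ι ℝ E) (w : ι → ℝ) (hw : ∑ i, w i = 1) (i : ι) :
    b.coord i (∑ j, w j • b j) = w i := by
  rw [← univ.affineCombination_eq_linear_combination b w hw,
    b.coord_apply_combination_of_mem (mem_univ i) hw]

theorem mainTheorem1 (d : ℕ) (hd₁ : 1 ≤ d) (hd₂ : d ≤ 28) (V : Fin (d + 1) → (Fin d → ℝ))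
    (hV : AffineIndependent ℝ V) :
    SimplexFejer.IsFejerSet 3 (SimplexFejer.simplex V) (SimplexFejer.degreeThreePoints V) := by
  let b : AffineBasis (Fin (d + 1)) ℝ (Fin d → ℝ) :=
    ⟨V, hV, hV.affineSpan_eq_top_iff_card_eq_finrank_add_one.2 (by simp)⟩
  let L : Fin (d + 1) → MvPolynomial (Fin d) ℝ := fun i => affinePolynomial (b.coord i)
  have hcoord : ∀ n i, b.coord i (nodePoint V n) = nodeCoord n i := fun n =>
    b.coord_sum_smul _ (sum_nodeCoord n)
  have heval : ∀ x n, MvPolynomial.eval x (nodeLagrange L n)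
      = nodeLagrange (fun i => b.coord i x) n := by
    intro x n
    -- Evaluation is an algebra map, so it carries the formula from polynomials to real coordinates.
    have h := map_nodeLagrange (MvPolynomial.aeval x : MvPolynomial (Fin d) ℝ →ₐ[ℝ] ℝ) L n
    simpa only [MvPolynomial.aeval_eq_eval, L, eval_affinePolynomial] using h
  have hdual : ∀ m n, MvPolynomial.eval (nodePoint V n) (nodeLagrange L m)
      = if m = n then 1 else 0 := by
    intro m n
    simp only [heval, hcoord]
    exact nodeLagrange_nodeCoord m n
  have hinj : Function.Injective (nodePoint V) := by
    intro m n h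
    by_contra hmn
    have h1 := hdual m m
    rw [h, hdual m n, if_neg hmn, if_pos rfl] at h1
    exact zero_ne_one h1
  have hsimplex : SimplexFejer.simplex V = {x | ∀ i, 0 ≤ b.coord i x} :=
    b.convexHull_eq_nonneg_coord
  rw [degreeThreePoints_eq_image]
  have hmem : ∀ n, nodePoint V n ∈ univ.image (nodePoint V) := fun n =>
    mem_image_of_mem _ (mem_univ n)
  have hcard : (univ.image (nodePoint V)).card = (3 + d).choose d := by
    rw [card_image_of_injective _ hinj, card_univ, card_nodeIndex]
  let e : NodeIndex (Fin (d + 1)) ≃ univ.image (nodePoint V) :=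
    Equiv.ofBijective (fun n => ⟨nodePoint V n, hmem n⟩)
      ⟨fun m n h => hinj (congrArg Subtype.val h), fun a => by
        obtain ⟨n, -, hn⟩ := mem_image.1 a.2
        exact ⟨n, Subtype.ext hn⟩⟩
  have he : ∀ a, nodePoint V (e.symm a) = a := fun a => congrArg Subtype.val (e.apply_symm_apply a)
  have hℓ : SimplexFejer.IsLagrangeFamily 3 (univ.image (nodePoint V))
      fun a => nodeLagrange L (e.symm a) := by
    refine ⟨fun a => ?_, fun a => ?_, fun a c hac => ?_⟩
    · rw [MvPolynomial.mem_restrictTotalDegree]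
      exact totalDegree_nodeLagrange_le L (fun i => totalDegree_affinePolynomial_le _) _
    · rw [← he a, hdual, if_pos rfl]
    · rw [← he c, hdual, if_neg (fun h => hac (e.symm.injective h))]
  have hsum : ∀ x, ∑ a, MvPolynomial.eval x (nodeLagrange L (e.symm a)) ^ 2
      = ∑ n, nodeLagrange (fun i => b.coord i x) n ^ 2 := fun x => by
    simp only [← heval]
    exact Equiv.sum_comp e.symm fun n => MvPolynomial.eval x (nodeLagrange L n) ^ 2
  refine ⟨?_, hcard, hℓ.isRegular ⟨_, hmem (.inl 0)⟩ (hcard.trans (finrank_polySpace_three d).symm),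
    _, hℓ, ?_, ?_⟩
  · intro a ha
    obtain ⟨n, -, rfl⟩ := mem_image.1 ha
    rw [hsimplex]
    intro i
    rw [hcoord]
    exact nodeCoord_nonneg n i
  -- At a node exactly one Lagrange polynomial is 1 and the others vanish, so a vertex attains the
  -- maximum.
  · refine ⟨V 0, subset_convexHull ℝ _ (Set.mem_range_self 0), ?_⟩
    simp only [hsum, ← heval]
    simp only [← nodePoint_vertex V 0, hdual]
    simp
  · rintro _ ⟨x, hx, rfl⟩
    rw [hsimplex] at hx
    simp only [hsum]
    exact sum_nodeLagrange_sq_le_one _ hx (b.sum_coord_apply_eq_one x)
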